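/- Let $n\ge 1$, let $A=(a_1,\dots,a_n)$ range over the row vectors of positive integers with $\gcd(a_1,\dots,a_n)=1$, and put $f_i=\gcd(a_1,\dots,a_i)$ and $$G(A)=\sum_{i=2}^{n} a_i\frac{f_{i-1}}{f_i}-\sum_{i=1}^{n}a_i .$$ Let $\Lambda(A)\subset\mathbb Z^{n-1}$ be the projection of the kernel lattice $\{x\in\mathbb Z^n: Ax=0\}$ that forgets the first coordinate, and, for $b\in\mathbb Z$, let $\Lambda(A,b)\subset\mathbb Z^{n-1}$ be the image of $\{x\in\mathbb Z^n: Ax=b\}$ under the same projection. (1) $\Lambda(A)$ has exactly one basis $g_1,\dots,g_{n-1}$ of the form $g_i=\sum_{j\le i}v_{ij}e_j$ with $v_{ii}>0$ and $0\le v_{ij}<v_{jj}$ for $j<i$ (its Hermite normal form), and the box $\mathcal B(\Lambda(A))=[0,v_{11})\times\cdots\times[0,v_{n-1\,n-1})$ is equal to $$\left[0,\frac{f_1}{f_2}\right)\times\left[0,\frac{f_2}{f_3}\right)\times\cdots\times\left[0,\frac{f_{n-1}}{f_n}\right).$$ (2) There is an algorithm (a single program of a random access machine on integers) which, given any such $A$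 (of any length $n$) and any $b\in\mathbb Z$, computes, in a number of bit operations bounded by a fixed polynomial in the binary encoding length of $(A,b)$, an integer solution $x$ of $Ax=b$ of the following form: $x=(u,w)$ with $w=z-y\in\mathcal B(\Lambda(A))$ for some $z\in\Lambda(A,b)$ and $y\in\Lambda(A)$, and $u=(b-a_2w_1-\cdots-a_nw_{n-1})/a_1$. If $b>G(A)$, then the computed solution $x$ is nonnegative. -/

import Mathlib

/-! ### Random access machines with bit cost -/

namespace RAM

/-- The number of bits of an integer in signed binary notation (one of them for the sign). -/
def bitLen (z : ℤ) : ℕ := Nat.size z.natAbs + 1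

/-- The arithmetic operations of the machine. -/
inductive Op where
  | add
  | sub
  | mul
  | div

/-- The value of an operation; `div` is Euclidean division (with value `0` for the divisor `0`). -/
def Op.eval : Op → ℤ → ℤ → ℤ
  | .add, x, y => x + y
  | .sub, x, y => x - y
  | .mul, x, y => x * y
  | .div, x, y => x / y

/-- Programs. A program mentions finitely many registers, each of which holds an integer. There is
also a memory, whose cells hold integers and are addressed by the content of a register. -/
inductive Prog where
  | skip
  /-- `reg r := c` -/
  | const (r : ℕ) (c : ℤ)
  /-- `reg r := reg p o reg q` -/
  | arith (o : Op) (r p q : ℕ)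
  /-- `reg r := mem (reg p)` -/
  | load (r p : ℕ)
  /-- `mem (reg p) := reg r` -/
  | store (p r : ℕ)
  /-- first `P`, then `Q` -/
  | seq (P Q : Prog)
  /-- `P` if `0 < reg r`, and `Q` otherwise -/
  | ifPos (r : ℕ) (P Q : Prog)
  /-- repeat `P` as long as `0 < reg r` -/
  | whilePos (r : ℕ) (P : Prog)

/-- The contents of the registers and of the memory. -/
structure State where
  reg : ℕ → ℤ
  mem : ℤ → ℤ

/-- `Exec P s t s'`: started in the state `s`, the program `P` halts in the state `s'`, and the
total cost of the execution, in bit operations, is `t`. An arithmetic operation costs the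
product of the bit lengths of its operands, a memory access the bit lengths of the address and
of the transported integer, a test the bit length of the tested integer. -/
inductive Exec : Prog → State → ℕ → State → Prop where
  | skip (s : State) : Exec .skip s 1 s
  | const (r : ℕ) (c : ℤ) (s : State) :
      Exec (.const r c) s (bitLen c) { s with reg := Function.update s.reg r c }
  | arith (o : Op) (r p q : ℕ) (s : State) :
      Exec (.arith o r p q) s (bitLen (s.reg p) * bitLen (s.reg q))
        { s with reg := Function.update s.reg r (o.eval (s.reg p) (s.reg q)) }
  | load (r p : ℕ) (s : State) :
      Exec (.load r p) s (bitLen (s.reg p) + bitLen (s.mem (s.reg p)))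
        { s with reg := Function.update s.reg r (s.mem (s.reg p)) }
  | store (p r : ℕ) (s : State) :
      Exec (.store p r) s (bitLen (s.reg p) + bitLen (s.reg r))
        { s with mem := Function.update s.mem (s.reg p) (s.reg r) }
  | seq {P Q : Prog} {s s' s'' : State} {t t' : ℕ} :
      Exec P s t s' → Exec Q s' t' s'' → Exec (.seq P Q) s (t + t') s''
  | ifPos_pos {r : ℕ} {P Q : Prog} {s s' : State} {t : ℕ} :
      0 < s.reg r → Exec P s t s' → Exec (.ifPos r P Q) s (bitLen (s.reg r) + t) s'
  | ifPos_nonpos {r : ℕ} {P Q : Prog} {s s' : State} {t : ℕ} :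
      s.reg r ≤ 0 → Exec Q s t s' → Exec (.ifPos r P Q) s (bitLen (s.reg r) + t) s'
  | whilePos_pos {r : ℕ} {P : Prog} {s s' s'' : State} {t t' : ℕ} :
      0 < s.reg r → Exec P s t s' → Exec (.whilePos r P) s' t' s'' →
        Exec (.whilePos r P) s (bitLen (s.reg r) + t + t') s''
  | whilePos_nonpos {r : ℕ} {P : Prog} {s : State} :
      s.reg r ≤ 0 → Exec (.whilePos r P) s (bitLen (s.reg r)) s

/-- The initial state for a list of integers as input: cell `0` holds the length of the list,
the cells `1, 2, …` hold its entries, and everything else is `0`. -/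
def inputState (l : List ℤ) : State where
  reg := fun _ => 0
  mem := fun j => if j = 0 then (l.length : ℤ) else if 0 < j then l.getD (j.toNat - 1) 0 else 0

/-- The output of a state is the list `l`: cell `0` holds its length, the cells `1, 2, …` hold its
entries. -/
def IsOutput (s : State) (l : List ℤ) : Prop :=
  s.mem 0 = l.length ∧ ∀ i : ℕ, i < l.length → s.mem ((i : ℤ) + 1) = l.getD i 0

/-- The binary encoding length of a list of integers. -/
def inputSize (l : List ℤ) : ℕ := (l.map bitLen).sum

/-- On the input `inp` the program `P` halts with the output `out`, after at most `T` bit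
operations. -/
def OutputsWithin (P : Prog) (inp out : List ℤ) (T : ℕ) : Prop :=
  ∃ (s : State) (t : ℕ), Exec P (inputState inp) t s ∧ t ≤ T ∧ IsOutput s out

end RAM

/-! ### Lattices and boxes

A row vector `(a₁, …, aₙ)` with `n = d + 1` entries is a function `a : Fin (d + 1) → ℤ`, with
`a 0 = a₁`. -/

namespace Knapsack

/-- `g` (with rows `g i`) is a basis of the lattice `L ⊆ ℤᵈ` which is lower triangular, with
positive diagonal entries, and whose entries below the diagonal are nonnegative and less than
the diagonal entry of the same column. -/
structure IsHermiteBasis {d : ℕ} (L : AddSubgroup (Fin d → ℤ)) (g : Fin d → Fin d → ℤ) : Prop where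
  linearIndependent : LinearIndependent ℤ g
  closure_eq : AddSubgroup.closure (Set.range g) = L
  upper_eq_zero : ∀ i j, i < j → g i j = 0
  diag_pos : ∀ i, 0 < g i i
  lower_nonneg : ∀ i j, j < i → 0 ≤ g i j
  lower_lt : ∀ i j, j < i → g i j < g j j

/-- The box `[0, v₁₁) × ⋯ × [0, v_dd)`, where the `vᵢᵢ` are the diagonal entries of the Hermite
basis of `L`. -/
def hermiteBox {d : ℕ} (L : AddSubgroup (Fin d → ℤ)) : Set (Fin d → ℝ) :=
  {w | ∃ g, IsHermiteBasis L g ∧ ∀ i, 0 ≤ w i ∧ w i < (g i i : ℝ)}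

/-- The integer points `x` with `a₁ x₁ + ⋯ + aₙ xₙ = 0`. -/
def kernelLattice {d : ℕ} (a : Fin (d + 1) → ℤ) : AddSubgroup (Fin (d + 1) → ℤ) where
  carrier := {x | ∑ i, a i * x i = 0}
  zero_mem' := by simp
  add_mem' := by
    intro x y hx hy
    simp only [Set.mem_ofPred_eq] at hx hy
    simp [mul_add, Finset.sum_add_distrib, hx, hy]
  neg_mem' := by
    intro x hx
    simp only [Set.mem_ofPred_eq] at hx
    simp [hx]

/-- The projection that forgets the first coordinate. -/
def forgetFirst (d : ℕ) : (Fin (d + 1) → ℤ) →+ (Fin d → ℤ) where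
  toFun x := fun i => x i.succ
  map_zero' := rfl
  map_add' _ _ := rfl

/-- The projection of the kernel lattice that forgets the first coordinate. -/
def projLattice {d : ℕ} (a : Fin (d + 1) → ℤ) : AddSubgroup (Fin d → ℤ) :=
  (kernelLattice a).map (forgetFirst d)

/-- The projection, forgetting the first coordinate, of the set of the integer solutions of
`a₁ x₁ + ⋯ + aₙ xₙ = b`. -/
def projSolutions {d : ℕ} (a : Fin (d + 1) → ℤ) (b : ℤ) : Set (Fin d → ℤ) :=
  forgetFirst d '' {x | ∑ i, a i * x i = b}

/-- `x` is what one obtains by taking a point `z` of the projected set of integer solutions,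
subtracting a point `y` of the projected kernel lattice such that `w = z - y` lies in the box of
that lattice, and lifting `w` to `x = (u, w)` with `u = (b - a₂ w₁ - ⋯ - aₙ wₙ₋₁) / a₁`. -/
def IsBoxSolution {d : ℕ} (a : Fin (d + 1) → ℤ) (b : ℤ) (x : Fin (d + 1) → ℤ) : Prop :=
  ∃ z ∈ projSolutions a b, ∃ y ∈ projLattice a,
    (fun i => ((z i - y i : ℤ) : ℝ)) ∈ hermiteBox (projLattice a) ∧
    (∀ i, x i.succ = z i - y i) ∧
    (x 0 : ℚ) = ((b : ℚ) - ∑ i : Fin d, (a i.succ : ℚ) * ((z i - y i : ℤ) : ℚ)) / (a 0 : ℚ)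

/-- `fᵢ = gcd (a₁, …, aᵢ)`. -/
def prefixGcd {d : ℕ} (a : Fin (d + 1) → ℤ) (i : Fin (d + 1)) : ℤ :=
  (Finset.Iic i).gcd a

/-- Brauer's bound `a₂ f₁ / f₂ + ⋯ + aₙ fₙ₋₁ / fₙ - (a₁ + ⋯ + aₙ)`. -/
def brauerBound {d : ℕ} (a : Fin (d + 1) → ℤ) : ℚ :=
  ∑ i : Fin d, (a i.succ : ℚ) * ((prefixGcd a i.castSucc : ℚ) / (prefixGcd a i.succ : ℚ))
    - ∑ i, (a i : ℚ)

end Knapsack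

/-! With one-based indices, a vector `w` lies in the projected kernel lattice exactly when `a₁`
divides `a₂ w₁ + ⋯ + aₙ wₙ₋₁` (`mem_projLattice`). If `wᵢ` is its last nonzero coordinate, reduction
modulo `fᵢ` gives `fᵢ ∣ aᵢ₊₁ wᵢ`, hence `fᵢ / fᵢ₊₁ ∣ wᵢ` (`quotient_dvd_of_dvd_sum`). Conversely, a
right-hand side divisible by `fᵢ₊₁` becomes divisible by `fᵢ` after subtracting `aᵢ₊₁` times a
suitable digit in `[0, fᵢ / fᵢ₊₁)`, found by Bézout (`dvd_sub_mul_digit`). Descending to `f₁ = a₁`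
yields lattice rows with diagonal `fᵢ / fᵢ₊₁` (`exists_digits`, `exists_isHermiteBasis`). The
divisibility shows that they generate, and a triangularity argument gives uniqueness.

The program performs the same descent on `b`: prefix gcds forwards, digits backwards, each by the
extended Euclidean algorithm. Bézout coefficients are kept reduced, and each digit changes the
right-hand side by at most one product of two small numbers, so all values fit into `4 S + 2` bits
for an input of length `S`. There are `O(d S)` instructions of cost `O(S²)` each. Digits are at most
`fᵢ / fᵢ₊₁ - 1`, so `b > G(A)` forces `a₁ u > -a₁`, that is, `u ≥ 0`. -/

namespace Knapsack

/-! ### Prefix gcds and the digit expansion. -/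

/-- The successive greatest common divisors of a sequence of integers. -/
def gcdSeq (a : ℕ → ℤ) : ℕ → ℤ
  | 0 => a 0
  | k + 1 => (Int.gcd (gcdSeq a k) (a (k + 1)) : ℤ)

theorem gcdSeq_pos {a : ℕ → ℤ} (h : ∀ k, 0 < a k) : ∀ k, 0 < gcdSeq a k
  | 0 => h 0
  | k + 1 => by
    have := Int.gcd_pos_of_ne_zero_right (gcdSeq a k) (h (k + 1)).ne'
    exact Int.natCast_pos.2 this

theorem gcdSeq_succ_dvd (a : ℕ → ℤ) (k : ℕ) : gcdSeq a (k + 1) ∣ gcdSeq a k :=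
  Int.gcd_dvd_left _ _

theorem gcdSeq_dvd (a : ℕ → ℤ) : ∀ k, gcdSeq a k ∣ a k
  | 0 => dvd_rfl
  | _ + 1 => Int.gcd_dvd_right _ _

theorem gcdSeq_dvd_of_le (a : ℕ → ℤ) {j k : ℕ} (h : j ≤ k) : gcdSeq a k ∣ gcdSeq a j := by
  induction h with
  | refl => rfl
  | step _ ih => exact (gcdSeq_succ_dvd a _).trans ih

theorem gcdSeq_dvd_entry (a : ℕ → ℤ) {j k : ℕ} (h : j ≤ k) : gcdSeq a k ∣ a j :=
  (gcdSeq_dvd_of_le a h).trans (gcdSeq_dvd a j)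

/-- The digit belonging to a Bézout coefficient `t`. -/
theorem dvd_sub_mul_digit {x y g t b : ℤ} (hgx : g ∣ x) (hgy : g ∣ y)
    (ht : x ∣ t * y - g) (hb : g ∣ b) : x ∣ b - y * (t * (b / g) % (x / g)) := by
  rcases eq_or_ne g 0 with rfl | hg
  · simp_all
  obtain ⟨x', rfl⟩ := hgx
  obtain ⟨y', rfl⟩ := hgy
  obtain ⟨b', rfl⟩ := hb
  rw [Int.mul_ediv_cancel_left _ hg, Int.mul_ediv_cancel_left _ hg]
  -- After division by `g`, `t` is an inverse of `y'` modulo `x'`, so `t * b'` solves the congruence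
  -- and may be reduced modulo `x'`.
  obtain ⟨c, hc⟩ := ht
  have hc' : t * y' - 1 = x' * c := by
    apply mul_left_cancel₀ hg; linear_combination hc
  have := Int.emod_add_mul_ediv (t * b') x'
  refine ⟨y' * (t * b' / x') - c * b', ?_⟩
  linear_combination (-g * y') * this - g * b' * hc'

/-- The last digit is chosen first: it makes the remainder divisible by the previous gcd, which is
what the recursion needs. The descent ends at `gcdSeq a 0 = a 0`. -/
theorem exists_digits {a : ℕ → ℤ} (h : ∀ k, 0 < a k) :
    ∀ (j : ℕ) (b : ℤ), gcdSeq a j ∣ b → ∃ w : ℕ → ℤ,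
      (∀ k < j, 0 ≤ w k ∧ w k < gcdSeq a k / gcdSeq a (k + 1)) ∧
      a 0 ∣ b - ∑ k ∈ Finset.range j, a (k + 1) * w k
  | 0, b, hb => ⟨0, by simp, by simpa [gcdSeq] using hb⟩
  | j + 1, b, hb => by
    set x := gcdSeq a j
    have hx : 0 < x := gcdSeq_pos h j
    have hg := gcdSeq_pos h (j + 1)
    have hm : 0 < x / gcdSeq a (j + 1) :=
      Int.ediv_pos_of_pos_of_dvd hx hg.le (gcdSeq_succ_dvd a j)
    have hbez := Int.gcd_eq_gcd_ab x (a (j + 1))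
    have key := dvd_sub_mul_digit (x := x) (t := Int.gcdB x (a (j + 1)))
      (gcdSeq_succ_dvd a j) (gcdSeq_dvd a (j + 1))
      ⟨-Int.gcdA x (a (j + 1)), by
        change _ - ((Int.gcd x (a (j + 1)) : ℕ) : ℤ) = _
        rw [hbez]; ring⟩ hb
    set v := Int.gcdB x (a (j + 1)) * (b / gcdSeq a (j + 1)) % (x / gcdSeq a (j + 1))
    obtain ⟨w, hw, hdvd⟩ := exists_digits h j _ key
    refine ⟨Function.update w j v, fun k hk => ?_, ?_⟩
    · rcases Nat.lt_succ_iff_lt_or_eq.1 hk with hk | rfl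
      · simpa [Function.update_of_ne hk.ne] using hw k hk
      · simpa using ⟨Int.emod_nonneg _ hm.ne', Int.emod_lt_of_pos _ hm⟩
    · rw [Finset.sum_range_succ, Function.update_self, Finset.sum_congr rfl (g := fun k => a (k + 1) * w k)]
      · convert hdvd using 1; ring
      · intro k hk
        rw [Function.update_of_ne (Finset.mem_range.1 hk).ne]

/-- A relation modulo `a 0` among the first entries forces divisibility of its last coefficient. -/
theorem quotient_dvd_of_dvd_sum {a : ℕ → ℤ} (h : ∀ k, 0 < a k) {j : ℕ} {y : ℕ → ℤ}
    (hy : a 0 ∣ ∑ k ∈ Finset.range (j + 1), a (k + 1) * y k) :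
    gcdSeq a j / gcdSeq a (j + 1) ∣ y j := by
  rw [Finset.sum_range_succ] at hy
  -- All terms before the last, and `a 0` itself, are multiples of `gcdSeq a j`; the cofactor of `a
  -- (j + 1)` is then cancelled by coprimality.
  have h1 : gcdSeq a j ∣ a (j + 1) * y j := by
    have := (gcdSeq_dvd_entry a (Nat.zero_le j)).trans hy
    refine (dvd_add_right ?_).1 this
    exact Finset.dvd_sum fun k hk =>
      (gcdSeq_dvd_entry a (Finset.mem_range.1 hk)).mul_right _
  have hg := gcdSeq_pos h (j + 1)
  have hcop := Int.gcd_ediv_gcd_ediv_gcd (Int.natCast_pos.1 hg)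
  change Int.gcd (gcdSeq a j / gcdSeq a (j + 1)) (a (j + 1) / gcdSeq a (j + 1)) = 1 at hcop
  refine Int.dvd_of_dvd_mul_right_of_gcd_one (b := a (j + 1) / gcdSeq a (j + 1)) ?_ hcop
  rw [mul_comm, ← Int.mul_ediv_assoc _ (gcdSeq_dvd a (j + 1)), mul_comm]
  exact Int.ediv_dvd_ediv (gcdSeq_succ_dvd a j) h1

/-- Extension of a vector of integers by `1`. -/
def extend {d : ℕ} (a : Fin (d + 1) → ℤ) (k : ℕ) : ℤ := if h : k < d + 1 then a ⟨k, h⟩ else 1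

/-- Padding with `1` keeps every entry positive, so the lemmas on infinite sequences need no range
conditions. -/
theorem extend_pos {d : ℕ} {a : Fin (d + 1) → ℤ} (h : ∀ i, 0 < a i) (k : ℕ) : 0 < extend a k := by
  unfold extend; split_ifs
  · exact h _
  · exact one_pos

@[simp] theorem extend_val {d : ℕ} (a : Fin (d + 1) → ℤ) (i : Fin (d + 1)) :
    extend a i = a i := by
  simp [extend, i.is_lt]

theorem prefixGcd_eq_gcdSeq {d : ℕ} {a : Fin (d + 1) → ℤ} (h : ∀ i, 0 < a i) :
    ∀ i, prefixGcd a i = gcdSeq (extend a) i := by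
  intro i
  induction i using Fin.induction with
  | zero =>
    have : (Finset.Iic (0 : Fin (d + 1))) = {0} := by ext j; simp
    rw [prefixGcd, this, Finset.gcd_singleton, Int.normalize_of_nonneg (h 0).le]
    exact (extend_val a 0).symm
  | succ i ih =>
    have : (Finset.Iic i.succ) = insert i.succ (Finset.Iic i.castSucc) := by
      ext j; simp [Fin.le_def, Fin.ext_iff]; omega
    rw [prefixGcd, this, Finset.gcd_insert, gcd_comm, ← prefixGcd, ih]
    have := extend_val a i.succ
    simp only [Fin.val_succ, Fin.val_castSucc] at this ⊢
    rw [gcdSeq, this, ← Int.coe_gcd]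

theorem gcdSeq_extend_last {d : ℕ} {a : Fin (d + 1) → ℤ} (h : ∀ i, 0 < a i)
    (h1 : Finset.univ.gcd a = 1) : gcdSeq (extend a) d = 1 := by
  have := prefixGcd_eq_gcdSeq h (Fin.last d)
  rw [Fin.val_last] at this
  rw [← this, ← h1, prefixGcd]
  congr 1
  ext j; simp [Fin.le_last]

end Knapsack

/-! ### Hermite bases and the projected kernel lattice. -/

namespace Knapsack

/-- By triangularity the coefficients of `y` can be read off from the last coordinate downwards.
Those beyond `i` vanish, so only row `i` contributes to `y i`. -/
theorem IsHermiteBasis.diag_dvd {d : ℕ} {L : AddSubgroup (Fin d → ℤ)} {g : Fin d → Fin d → ℤ}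
    (hg : IsHermiteBasis L g) {y : Fin d → ℤ} (hy : y ∈ L) {i : Fin d}
    (h0 : ∀ k, i < k → y k = 0) : g i i ∣ y i := by
  rw [← hg.closure_eq, ← Submodule.span_int_eq_addSubgroupClosure, Submodule.mem_toAddSubgroup,
    Submodule.mem_span_range_iff_exists_fun] at hy
  obtain ⟨c, rfl⟩ := hy
  have hsum : ∀ k, (∀ l, k < l → c l = 0) → (∑ l, c l • g l) k = c k * g k k := by
    intro k hk
    rw [Finset.sum_apply, Finset.sum_eq_single k]
    · simp
    · intro l _ hl
      rcases lt_or_gt_of_ne hl with hl | hl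
      · simp [hg.upper_eq_zero l k hl]
      · simp [hk l hl]
    · simp
  have hc : ∀ k, i < k → c k = 0 := by
    intro k
    induction k using WellFoundedGT.induction with
    | ind k ih =>
      intro hik
      have h1 := hsum k fun l hl => ih l hl (hik.trans hl)
      rw [h0 k hik] at h1
      exact (mul_eq_zero.1 h1.symm).resolve_right (hg.diag_pos k).ne'
  rw [hsum i hc]
  exact dvd_mul_left _ _

theorem IsHermiteBasis.mem {d : ℕ} {L : AddSubgroup (Fin d → ℤ)} {g : Fin d → Fin d → ℤ}
    (hg : IsHermiteBasis L g) (i : Fin d) : g i ∈ L :=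
  hg.closure_eq ▸ AddSubgroup.subset_closure ⟨i, rfl⟩

theorem IsHermiteBasis.unique {d : ℕ} {L : AddSubgroup (Fin d → ℤ)} {g h : Fin d → Fin d → ℤ}
    (hg : IsHermiteBasis L g) (hh : IsHermiteBasis L h) : g = h := by
  have hdiag : ∀ i, g i i = h i i := fun i =>
    Int.dvd_antisymm (hg.diag_pos i).le (hh.diag_pos i).le
      (hg.diag_dvd (hh.mem i) (hh.upper_eq_zero i)) (hh.diag_dvd (hg.mem i) (hg.upper_eq_zero i))
  funext i j
  induction j using WellFoundedGT.induction with
  | ind j ih =>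
    rcases lt_trichotomy i j with hij | rfl | hij
    · rw [hg.upper_eq_zero i j hij, hh.upper_eq_zero i j hij]
    · exact hdiag i
    -- Columns are compared from right to left: the difference of the two rows vanishes beyond `j`,
    -- so its entry at `j` is a multiple of the common diagonal entry, yet smaller in absolute
    -- value.
    · have hdvd := hg.diag_dvd (L.sub_mem (hg.mem i) (hh.mem i)) (i := j)
        fun k hk => sub_eq_zero.2 (ih k hk)
      refine sub_eq_zero.1 (Int.eq_zero_of_abs_lt_dvd hdvd ?_)
      have h1 := hg.lower_nonneg i j hij
      have h2 := hg.lower_lt i j hij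
      have h3 := hh.lower_nonneg i j hij
      have h4 := hh.lower_lt i j hij
      have h5 := hdiag j
      rw [abs_lt]
      constructor <;> omega

/-- The divisibility lets a multiple of row `i` clear the last nonzero coordinate of a lattice
vector; repeating this shows that the rows generate. Independence follows from the nonzero
determinant. -/
theorem isHermiteBasis_of_diag_dvd {d : ℕ} {L : AddSubgroup (Fin d → ℤ)} {g : Fin d → Fin d → ℤ}
    (hmem : ∀ i, g i ∈ L) (hupper : ∀ i j, i < j → g i j = 0) (hpos : ∀ i, 0 < g i i)
    (hlower : ∀ i j, j < i → 0 ≤ g i j ∧ g i j < g j j)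
    (hdvd : ∀ y ∈ L, ∀ i, (∀ k, i < k → y k = 0) → g i i ∣ y i) : IsHermiteBasis L g where
  upper_eq_zero := hupper
  diag_pos := hpos
  lower_nonneg i j h := (hlower i j h).1
  lower_lt i j h := (hlower i j h).2
  linearIndependent := by
    refine Matrix.linearIndependent_rows_of_det_ne_zero (A := Matrix.of g) ?_
    rw [Matrix.det_of_isLowerTriangular (Matrix.of g) fun i j hij => hupper i j hij]
    exact Finset.prod_ne_zero_iff.2 fun i _ => (hpos i).ne'
  closure_eq := by
    refine le_antisymm ((AddSubgroup.closure_le L).2 (Set.range_subset_iff.2 hmem)) ?_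
    have key : ∀ n : ℕ, ∀ y ∈ L, (∀ k : Fin d, n ≤ k → y k = 0) →
        y ∈ AddSubgroup.closure (Set.range g) := by
      intro n
      induction n with
      | zero =>
        intro y _ h0
        rw [show y = 0 from funext fun k => h0 k (Nat.zero_le _)]
        exact zero_mem _
      | succ n ih =>
        intro y hy h0
        rcases lt_or_ge n d with hn | hn
        · obtain ⟨c, hc⟩ := hdvd y hy ⟨n, hn⟩ fun k hk => h0 k hk
          have hgn : g ⟨n, hn⟩ ∈ AddSubgroup.closure (Set.range g) :=
            AddSubgroup.subset_closure ⟨_, rfl⟩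
          have := ih (y - c • g ⟨n, hn⟩) (L.sub_mem hy (L.zsmul_mem (hmem _) c)) fun k hk => by
            rcases hk.eq_or_lt with hk | hk
            · obtain rfl : k = ⟨n, hn⟩ := Fin.ext hk.symm
              simp [hc, mul_comm]
            · simp [h0 k hk, hupper ⟨n, hn⟩ k hk]
          simpa using add_mem this (AddSubgroup.zsmul_mem _ hgn c)
        · exact ih y hy fun k hk => absurd k.is_lt (by omega)
    exact fun y hy => key d y hy fun k hk => absurd k.is_lt (by omega)

/-- The forgotten coordinate is determined by the others, up to divisibility by `a 0`. -/
theorem mem_projLattice {d : ℕ} {a : Fin (d + 1) → ℤ} {y : Fin d → ℤ} :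
    y ∈ projLattice a ↔ a 0 ∣ ∑ i : Fin d, a i.succ * y i := by
  constructor
  · rintro ⟨x, hx, rfl⟩
    change ∑ i, a i * x i = 0 at hx
    rw [Fin.sum_univ_succ] at hx
    exact ⟨-x 0, by change ∑ i : Fin d, a i.succ * x i.succ = _; linear_combination hx⟩
  · rintro ⟨c, hc⟩
    refine ⟨Fin.cons (-c) y, ?_, funext fun i => ?_⟩
    · change ∑ i, a i * (Fin.cons (-c) y : Fin (d + 1) → ℤ) i = 0
      rw [Fin.sum_univ_succ]
      simp [hc]
    · simp [forgetFirst]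

theorem sum_succ_eq_sum_range {d : ℕ} (a : Fin (d + 1) → ℤ) (y : ℕ → ℤ) :
    ∑ i : Fin d, a i.succ * y i = ∑ k ∈ Finset.range d, extend a (k + 1) * y k := by
  rw [← Fin.sum_univ_eq_sum_range (fun k => extend a (k + 1) * y k)]
  exact Finset.sum_congr rfl fun i _ => by rw [← extend_val a i.succ, Fin.val_succ]

theorem quotient_dvd_of_mem_projLattice {d : ℕ} {a : Fin (d + 1) → ℤ} (ha : ∀ i, 0 < a i)
    {y : Fin d → ℤ} (hy : y ∈ projLattice a) {i : Fin d} (h0 : ∀ k, i < k → y k = 0) :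
    gcdSeq (extend a) i / gcdSeq (extend a) (i + 1) ∣ y i := by
  obtain ⟨Y, rfl⟩ : ∃ Y : ℕ → ℤ, y = fun j : Fin d => Y j :=
    ⟨fun k => if h : k < d then y ⟨k, h⟩ else 0, by simp⟩
  rw [mem_projLattice, sum_succ_eq_sum_range, ← extend_val a 0] at hy
  refine quotient_dvd_of_dvd_sum (extend_pos ha) ?_
  refine hy.trans (dvd_of_eq (Eq.symm ?_))
  refine Finset.sum_subset (Finset.range_subset_range.2 i.is_lt) fun k hk hki => ?_
  rw [Finset.mem_range] at hk hki
  rw [show Y k = 0 from h0 ⟨k, hk⟩ (Fin.lt_def.2 (by simp only; omega)), mul_zero]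

theorem gcdSeq_quotient_pos {a : ℕ → ℤ} (h : ∀ k, 0 < a k) (k : ℕ) :
    0 < gcdSeq a k / gcdSeq a (k + 1) :=
  Int.ediv_pos_of_pos_of_dvd (gcdSeq_pos h k) (gcdSeq_pos h _).le (gcdSeq_succ_dvd a k)

/-- Row `i` has the quotient on the diagonal, and to its left the digits that cancel the diagonal's
contribution modulo `a 0`. The digit ranges are exactly the Hermite bounds. -/
theorem exists_isHermiteBasis {d : ℕ} {a : Fin (d + 1) → ℤ} (ha : ∀ i, 0 < a i) :
    ∃ g, IsHermiteBasis (projLattice a) g ∧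
      ∀ i : Fin d, g i i = gcdSeq (extend a) i / gcdSeq (extend a) (i + 1) := by
  set A := extend a
  have hA : ∀ k, 0 < A k := extend_pos ha
  have hdig : ∀ i : ℕ, gcdSeq A i ∣ -(A (i + 1) * (gcdSeq A i / gcdSeq A (i + 1))) := by
    intro i
    obtain ⟨c, hc⟩ := gcdSeq_dvd A (i + 1)
    refine ⟨-c, ?_⟩
    linear_combination (gcdSeq A i / gcdSeq A (i + 1)) * (-hc) -
      c * Int.mul_ediv_cancel' (gcdSeq_succ_dvd A i)
  choose w hw hsum using fun i : ℕ => exists_digits hA i _ (hdig i)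
  let G : ℕ → ℕ → ℤ := fun i k =>
    if k < i then w i k else if k = i then gcdSeq A i / gcdSeq A (i + 1) else 0
  have hG : ∀ i, G i i = gcdSeq A i / gcdSeq A (i + 1) := fun i => by simp [G]
  refine ⟨fun i k => G i k, isHermiteBasis_of_diag_dvd ?_ ?_ ?_ ?_ ?_, fun i => hG i⟩
  · intro i
    rw [mem_projLattice, sum_succ_eq_sum_range, ← extend_val a 0, Fin.val_zero,
      ← Finset.sum_subset (Finset.range_subset_range.2 (Nat.succ_le_of_lt i.is_lt)),
      Nat.succ_eq_add_one, Finset.sum_range_succ, hG,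
      Finset.sum_congr rfl (g := fun k => A (k + 1) * w i k)]
    · refine (Int.dvd_neg.2 (hsum i)).trans (dvd_of_eq ?_)
      ring
    · intro k hk
      simp [G, Finset.mem_range.1 hk, A]
    · intro k _ hk
      rw [Finset.mem_range] at hk
      simp [G, show ¬ k < i by omega, show k ≠ i by omega]
  · intro i j hij
    have : (i : ℕ) < j := hij
    simp [G, show ¬ (j : ℕ) < i by omega, show (j : ℕ) ≠ i by omega]
  · intro i
    rw [hG]
    exact gcdSeq_quotient_pos hA i
  · intro i j hij
    have h1 : (j : ℕ) < i := hij
    rw [hG]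
    simpa [G, h1] using hw i j h1
  · intro y hy i h0
    rw [hG]
    exact quotient_dvd_of_mem_projLattice ha hy h0

theorem existsUnique_isHermiteBasis {d : ℕ} {a : Fin (d + 1) → ℤ} (ha : ∀ i, 0 < a i) :
    ∃! g, IsHermiteBasis (projLattice a) g := by
  obtain ⟨g, hg, -⟩ := exists_isHermiteBasis ha
  exact ⟨g, hg, fun h hh => hh.unique hg⟩

theorem hermiteBox_projLattice {d : ℕ} {a : Fin (d + 1) → ℤ} (ha : ∀ i, 0 < a i) :
    hermiteBox (projLattice a) = Set.pi Set.univ (fun i : Fin d => Set.Ico (0 : ℝ)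
      ((prefixGcd a i.castSucc : ℝ) / (prefixGcd a i.succ : ℝ))) := by
  obtain ⟨g, hg, hdiag⟩ := exists_isHermiteBasis ha
  have hcast : ∀ i : Fin d, (g i i : ℝ) = (prefixGcd a i.castSucc : ℝ) / prefixGcd a i.succ := by
    intro i
    rw [hdiag, prefixGcd_eq_gcdSeq ha, prefixGcd_eq_gcdSeq ha, Fin.val_castSucc, Fin.val_succ]
    exact Int.cast_div (gcdSeq_succ_dvd _ _)
      (Int.cast_ne_zero.2 (gcdSeq_pos (extend_pos ha) _).ne')
  ext w
  simp only [hermiteBox, Set.mem_ofPred_eq, Set.mem_univ_pi, Set.mem_Ico, ← hcast]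
  constructor
  · rintro ⟨h, hh, hw⟩
    rwa [hh.unique hg] at hw
  · exact fun hw => ⟨g, hg, hw⟩

/-! ### Box solutions and Brauer's bound. -/

theorem isBoxSolution_of_digits {d : ℕ} {a : Fin (d + 1) → ℤ} (ha : ∀ i, 0 < a i) {b : ℤ}
    {x : Fin (d + 1) → ℤ} (hx : ∑ i, a i * x i = b)
    (hdig : ∀ i : Fin d, 0 ≤ x i.succ ∧
      x i.succ < gcdSeq (extend a) i / gcdSeq (extend a) (i + 1)) :
    IsBoxSolution a b x := by
  obtain ⟨g, hg, hdiag⟩ := exists_isHermiteBasis ha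
  -- The solution is already reduced, so `z` is its own projection and `y = 0`.
  refine ⟨_, ⟨x, hx, rfl⟩, 0, zero_mem _, ⟨g, hg, fun i => ?_⟩, fun i => ?_, ?_⟩
  · rw [hdiag]
    simp only [forgetFirst, AddMonoidHom.coe_mk, ZeroHom.coe_mk, Pi.zero_apply, sub_zero]
    exact_mod_cast hdig i
  · simp [forgetFirst]
  · rw [eq_div_iff (Int.cast_ne_zero.2 (ha 0).ne'), ← hx, Fin.sum_univ_succ]
    push_cast
    simp [forgetFirst, mul_comm]

theorem nonneg_of_brauerBound_lt {d : ℕ} {a : Fin (d + 1) → ℤ} (ha : ∀ i, 0 < a i) {b : ℤ}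
    {x : Fin (d + 1) → ℤ} (hx : ∑ i, a i * x i = b)
    (hdig : ∀ i : Fin d, 0 ≤ x i.succ ∧
      x i.succ < gcdSeq (extend a) i / gcdSeq (extend a) (i + 1))
    (hb : brauerBound a < b) : ∀ i, 0 ≤ x i := by
  intro i
  induction i using Fin.cases with
  | succ i => exact (hdig i).1
  | zero =>
    have hq : brauerBound a = ((∑ i : Fin d, a i.succ *
        (gcdSeq (extend a) i / gcdSeq (extend a) (i + 1)) - ∑ i, a i : ℤ) : ℚ) := by
      rw [brauerBound]
      push_cast
      congr 1
      refine Finset.sum_congr rfl fun i _ => ?_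
      rw [prefixGcd_eq_gcdSeq ha, prefixGcd_eq_gcdSeq ha, Fin.val_castSucc, Fin.val_succ,
        Int.cast_div (gcdSeq_succ_dvd _ _)
          (Int.cast_ne_zero.2 (gcdSeq_pos (extend_pos ha) _).ne')]
    rw [hq, Int.cast_lt, ← hx, Fin.sum_univ_succ, Fin.sum_univ_succ] at hb
    have hle : ∑ i : Fin d, a i.succ * x i.succ ≤ ∑ i : Fin d, a i.succ *
        (gcdSeq (extend a) i / gcdSeq (extend a) (i + 1)) - ∑ i : Fin d, a i.succ := by
      rw [← Finset.sum_sub_distrib]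
      refine Finset.sum_le_sum fun i _ => ?_
      -- Integrality sharpens the strict bound to digit plus one; this accounts for the subtracted
      -- sum in Brauer's bound and leaves only `a 0` to compare.
      have := mul_le_mul_of_nonneg_left (Int.add_one_le_of_lt (hdig i).2) (ha i.succ).le
      linarith
    by_contra hneg
    have := mul_le_mul_of_nonneg_left (show x 0 ≤ -1 by omega) (ha 0).le
    linarith

end Knapsack

/-! ### Cost calculus for programs. -/

namespace RAM

/-- The absolute value of `z` has at most `k` bits. -/
def Fits (k : ℕ) (z : ℤ) : Prop := |z| < 2 ^ k

theorem Fits.bitLen_le {k : ℕ} {z : ℤ} (h : Fits k z) : bitLen z ≤ k + 1 := by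
  refine Nat.succ_le_succ (Nat.size_le.2 ?_)
  unfold Fits at h
  rw [Int.abs_eq_natAbs] at h
  exact_mod_cast h

theorem fits_zero (k : ℕ) : Fits k 0 := by simp [Fits]

/-- Started in `s`, the program `P` halts in a state that satisfies `Q`, and the execution costs at
most `K` times the square of `k + 1` bit operations. -/
def Reaches (k : ℕ) (P : Prog) (s : State) (K : ℕ) (Q : State → Prop) : Prop :=
  ∃ t s', Exec P s t s' ∧ t ≤ K * (k + 1) ^ 2 ∧ Q s'

theorem Reaches.mono {k K K' : ℕ} {P : Prog} {s : State} {Q Q' : State → Prop}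
    (h : Reaches k P s K Q) (hK : K ≤ K') (hQ : ∀ s', Q s' → Q' s') : Reaches k P s K' Q' := by
  obtain ⟨t, s', he, ht, hq⟩ := h
  exact ⟨t, s', he, ht.trans (Nat.mul_le_mul_right _ hK), hQ s' hq⟩

/-- With one bit width `k` fixed for the whole run, the constants add, and the cost analysis becomes
a count of instructions. -/
theorem Reaches.seq {k K K' : ℕ} {P R : Prog} {s : State} {Q Q' : State → Prop}
    (h : Reaches k P s K Q) (h' : ∀ s', Q s' → Reaches k R s' K' Q') :
    Reaches k (.seq P R) s (K + K') Q' := by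
  obtain ⟨t, s', he, ht, hq⟩ := h
  obtain ⟨t', s'', he', ht', hq'⟩ := h' s' hq
  exact ⟨t + t', s'', he.seq he', by rw [add_mul]; exact add_le_add ht ht', hq'⟩

/-- The index of `Inv` bounds the number of rounds still possible; at index `0` the step hypothesis
rules out another round. Each round pays `c` and one test, and the final `1` pays for the failing
test. -/
theorem reaches_whilePos {k r c : ℕ} {P : Prog} {Inv : ℕ → State → Prop}
    (hfit : ∀ j s, Inv j s → Fits k (s.reg r))
    (hstep : ∀ j s, Inv j s → 0 < s.reg r → ∃ j', j = j' + 1 ∧ Reaches k P s c (Inv j')) :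
    ∀ j s, Inv j s → Reaches k (.whilePos r P) s ((c + 1) * j + 1)
      fun s' => s'.reg r ≤ 0 ∧ ∃ j', Inv j' s' := by
  intro j
  induction j with
  | zero =>
    intro s hs
    have hr : s.reg r ≤ 0 := by
      by_contra! hr
      obtain ⟨j', h, -⟩ := hstep 0 s hs hr
      omega
    refine ⟨_, s, .whilePos_nonpos hr, ?_, hr, 0, hs⟩
    have := (hfit 0 s hs).bitLen_le
    nlinarith
  | succ j ih =>
    intro s hs
    have hb := (hfit _ s hs).bitLen_le
    rcases le_or_gt (s.reg r) 0 with hr | hr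
    · refine ⟨_, s, .whilePos_nonpos hr, ?_, hr, _, hs⟩
      nlinarith [Nat.zero_le ((c + 1) * (j + 1) * (k + 1) ^ 2)]
    · obtain ⟨j', h, t, s', he, ht, hs'⟩ := hstep _ s hs hr
      obtain rfl : j = j' := by omega
      obtain ⟨t', s'', he', ht', hq⟩ := ih s' hs'
      refine ⟨_, s'', .whilePos_pos hr he he', ?_, hq⟩
      nlinarith

/-- Execute the programs of a list one after the other. -/
def Prog.block : List Prog → Prog
  | [] => .skip
  | P :: l => .seq P (block l)

/-- Assign a value to a register. -/
def State.setReg (s : State) (r : ℕ) (v : ℤ) : State :=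
  { s with reg := Function.update s.reg r v }

/-- Assign a value to a memory cell. -/
def State.setMem (s : State) (j v : ℤ) : State :=
  { s with mem := Function.update s.mem j v }

@[simp] theorem State.setReg_reg (s : State) (r : ℕ) (v : ℤ) (q : ℕ) :
    (s.setReg r v).reg q = if q = r then v else s.reg q := Function.update_apply ..

@[simp] theorem State.setReg_mem (s : State) (r : ℕ) (v : ℤ) : (s.setReg r v).mem = s.mem := rfl

@[simp] theorem State.setMem_reg (s : State) (j v : ℤ) : (s.setMem j v).reg = s.reg := rfl

@[simp] theorem State.setMem_mem (s : State) (j v i : ℤ) :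
    (s.setMem j v).mem i = if i = j then v else s.mem i := Function.update_apply ..

@[simp] theorem Op.eval_add (x y : ℤ) : Op.eval .add x y = x + y := rfl
@[simp] theorem Op.eval_sub (x y : ℤ) : Op.eval .sub x y = x - y := rfl
@[simp] theorem Op.eval_mul (x y : ℤ) : Op.eval .mul x y = x * y := rfl
@[simp] theorem Op.eval_div (x y : ℤ) : Op.eval .div x y = x / y := rfl

namespace Reaches

variable {k K : ℕ} {s : State} {Q : State → Prop} {l : List Prog}

theorem nil (h : Q s) : Reaches k (.block []) s 1 Q :=
  ⟨1, s, .skip s, by simpa using Nat.one_le_pow 2 (k + 1) (by omega), h⟩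

theorem cons {K' : ℕ} {P : Prog} {Q' : State → Prop} (h : Reaches k P s K Q)
    (h' : ∀ s', Q s' → Reaches k (.block l) s' K' Q') :
    Reaches k (.block (P :: l)) s (K' + K) Q' :=
  add_comm K K' ▸ h.seq h'

theorem const {r : ℕ} {c : ℤ} (hc : Fits k c) (h : Reaches k (.block l) (s.setReg r c) K Q) :
    Reaches k (.block (.const r c :: l)) s (K + 1) Q := by
  refine cons (Q := (· = s.setReg r c)) ⟨_, _, .const r c s, ?_, rfl⟩ fun _ hs => hs ▸ h
  have := hc.bitLen_le
  nlinarith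

/-- This product of two bit lengths is the reason for the square in `Reaches`. The operands enter
through equations so that later states display values instead of register look-ups. -/
theorem arith {o : Op} {r p q : ℕ} {x y : ℤ} (hx : s.reg p = x ∧ Fits k x)
    (hy : s.reg q = y ∧ Fits k y)
    (h : Reaches k (.block l) (s.setReg r (o.eval x y)) K Q) :
    Reaches k (.block (.arith o r p q :: l)) s (K + 1) Q := by
  obtain ⟨rfl, hx⟩ := hx
  obtain ⟨rfl, hy⟩ := hy
  refine cons (Q := (· = s.setReg r _)) ⟨_, _, .arith o r p q s, ?_, rfl⟩ fun _ hs => hs ▸ h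
  have := Nat.mul_le_mul hx.bitLen_le hy.bitLen_le
  nlinarith

theorem load {r p : ℕ} {j v : ℤ} (hj : s.reg p = j ∧ Fits k j) (hv : s.mem j = v ∧ Fits k v)
    (h : Reaches k (.block l) (s.setReg r v) K Q) :
    Reaches k (.block (.load r p :: l)) s (K + 2) Q := by
  obtain ⟨rfl, hj⟩ := hj
  obtain ⟨rfl, hv⟩ := hv
  refine cons (Q := (· = s.setReg r _)) ⟨_, _, .load r p s, ?_, rfl⟩ fun _ hs => hs ▸ h
  have := hj.bitLen_le
  have := hv.bitLen_le
  nlinarith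

theorem store {p r : ℕ} {j v : ℤ} (hj : s.reg p = j ∧ Fits k j) (hv : s.reg r = v ∧ Fits k v)
    (h : Reaches k (.block l) (s.setMem j v) K Q) :
    Reaches k (.block (.store p r :: l)) s (K + 2) Q := by
  obtain ⟨rfl, hj⟩ := hj
  obtain ⟨rfl, hv⟩ := hv
  refine cons (Q := (· = s.setMem _ _)) ⟨_, _, .store p r s, ?_, rfl⟩ fun _ hs => hs ▸ h
  have := hj.bitLen_le
  have := hv.bitLen_le
  nlinarith

end Reaches

/-! ### The extended Euclidean algorithm. -/

/-- One division step of the extended Euclidean algorithm. -/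
def euclidStep : Prog := .block
  -- Registers `5`, `6` hold consecutive remainders and `7`, `8` their coefficients; adding register
  -- `0`, which stays zero, copies a register.
  [.arith .div 9 5 6, .arith .mul 10 9 6, .arith .sub 10 5 10,
   .arith .mul 9 9 8, .arith .sub 9 7 9, .arith .add 7 8 0,
   -- Reducing the new coefficient modulo register `3` prevents growth over the rounds.
   .arith .div 8 9 3, .arith .mul 8 8 3, .arith .sub 8 9 8,
   .arith .add 5 6 0, .arith .add 6 10 0]

/-- The extended Euclidean algorithm for the contents `x` and `y` of the registers `3` and `4`. It
leaves `gcd x y` in register `5`, and a Bézout coefficient of `y` modulo `x` in register `7`. -/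
def euclid : Prog := .block
  [.arith .add 5 3 0, .arith .div 9 4 3, .arith .mul 9 9 3, .arith .sub 6 4 9,
   .arith .add 7 0 0, .const 8 1, .whilePos 6 euclidStep]

/-- The invariant of the loop in `euclid`, started in the state `s₀`. -/
structure EuclidInv (s₀ : State) (j : ℕ) (s : State) : Prop where
  mem : s.mem = s₀.mem
  reg : ∀ r, r < 5 ∨ 10 < r → s.reg r = s₀.reg r
  pos : 0 < s.reg 5
  le : s.reg 5 ≤ s₀.reg 3
  nonneg : 0 ≤ s.reg 6
  le' : s.reg 6 ≤ s.reg 5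
  -- This product is at least halved in every round.
  lt : s.reg 5 * s.reg 6 < 2 ^ j
  coeff : 0 ≤ s.reg 7 ∧ s.reg 7 ≤ s₀.reg 3
  -- Not strict, since register `8` starts at `1` and register `3` may be `1`.
  coeff' : 0 ≤ s.reg 8 ∧ s.reg 8 ≤ s₀.reg 3
  dvd : s₀.reg 3 ∣ s.reg 7 * s₀.reg 4 - s.reg 5
  dvd' : s₀.reg 3 ∣ s.reg 8 * s₀.reg 4 - s.reg 6
  gcd_eq : Int.gcd (s.reg 5) (s.reg 6) = Int.gcd (s₀.reg 3) (s₀.reg 4)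

/-- The quotient is at least `1`, so `x` exceeds the remainder by at least `y`, which is larger than
the remainder. -/
theorem two_mul_emod_le {x y : ℤ} (hy : 0 < y) (h : y ≤ x) : 2 * (x % y) ≤ x := by
  have h1 := Int.emod_lt_of_pos x hy
  have h2 := Int.emod_add_mul_ediv x y
  have h3 : 1 ≤ x / y := (Int.le_ediv_iff_mul_le hy).2 (by simpa)
  nlinarith

theorem reaches_euclidStep {s₀ s : State} {k j : ℕ} {N : ℤ} (h0 : s₀.reg 0 = 0) (hN : s₀.reg 3 < N)
    (hk : 4 * N ^ 2 ≤ 2 ^ k) (hs : EuclidInv s₀ j s) (h : 0 < s.reg 6) :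
    ∃ j', j = j' + 1 ∧ Reaches k euclidStep s 12 (EuclidInv s₀ j') := by
  obtain ⟨hmem, hreg, hpos, hle, -, hle', hlt, hc, hc', hdvd, hdvd', hgcd⟩ := hs
  have e0 : s.reg 0 = 0 := (hreg 0 (by omega)).trans h0
  have e3 : s.reg 3 = s₀.reg 3 := hreg 3 (by omega)
  generalize eX : s₀.reg 3 = X at *
  generalize eY : s₀.reg 4 = Y at *
  generalize e5 : s.reg 5 = r at *
  generalize e6 : s.reg 6 = r' at *
  generalize e7 : s.reg 7 = t at *
  generalize e8 : s.reg 8 = t' at *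
  have hj : j ≠ 0 := by
    rintro rfl
    nlinarith
  obtain ⟨j, rfl⟩ := Nat.exists_eq_succ_of_ne_zero hj
  refine ⟨j, rfl, ?_⟩
  have hX : 0 < X := by omega
  have hN1 : 1 ≤ N := by omega
  have hNN : N ≤ N ^ 2 := by nlinarith
  -- The weakest estimate is the one for `u / X * X`: at most `N ^ 2 + N` for `u`, and one further
  -- `N` for its remainder.
  have fits : ∀ z : ℤ, |z| ≤ 3 * N ^ 2 → Fits k z := fun z hz =>
    lt_of_lt_of_le (by linarith) hk
  have hq0 : 0 ≤ r / r' := Int.ediv_nonneg hpos.le h.le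
  have hq1 : r / r' ≤ r := Int.ediv_le_self _ hpos.le
  have hm := Int.emod_add_mul_ediv r r'
  have hm0 := Int.emod_nonneg r h.ne'
  have hm1 := Int.emod_lt_of_pos r h
  have hr2 : r - r / r' * r' = r % r' := by linear_combination -hm
  have hqt0 : 0 ≤ r / r' * t' := mul_nonneg hq0 hc'.1
  have hqt : r / r' * t' ≤ N ^ 2 := by
    rw [sq]; exact mul_le_mul (by omega) (by omega) hc'.1 (by omega)
  have hu : |t - r / r' * t'| ≤ N ^ 2 + N := by rw [abs_le]; constructor <;> linarith
  set u := t - r / r' * t' with hudef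
  have hu0 := Int.emod_nonneg u hX.ne'
  have hu1 := Int.emod_lt_of_pos u hX
  have hum := Int.emod_add_mul_ediv u X
  have hur : u - u / X * X = u % X := by linear_combination -hum
  have f0 : Fits k 0 := fits_zero k
  have fX : Fits k X := fits _ (by rw [abs_le]; constructor <;> linarith)
  have fr : Fits k r := fits _ (by rw [abs_le]; constructor <;> linarith)
  have fr' : Fits k r' := fits _ (by rw [abs_le]; constructor <;> linarith)
  have ft : Fits k t := fits _ (by rw [abs_le]; constructor <;> linarith)
  have ft' : Fits k t' := fits _ (by rw [abs_le]; constructor <;> linarith)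
  have fq : Fits k (r / r') := fits _ (by rw [abs_le]; constructor <;> linarith)
  have fqr : Fits k (r / r' * r') := fits _ (by rw [abs_le]; constructor <;> linarith)
  have fr2 : Fits k (r - r / r' * r') := fits _ (by rw [abs_le]; constructor <;> linarith)
  have fqt : Fits k (r / r' * t') := fits _ (by rw [abs_le]; constructor <;> linarith)
  have fu : Fits k u := fits _ (hu.trans (by linarith))
  have fd : Fits k (u / X) := fits _ ((Int.abs_ediv_le_abs _ _).trans (hu.trans (by linarith)))
  have fdX : Fits k (u / X * X) := fits _ (by
    rw [abs_le] at hu ⊢; constructor <;> linarith)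
  rw [hudef] at fu fd fdX
  refine .arith ⟨by simp [e5], fr⟩ ⟨by simp [e6], fr'⟩ ?_
  refine .arith ⟨by simp, fq⟩ ⟨by simp [e6], fr'⟩ ?_
  refine .arith ⟨by simp [e5], fr⟩ ⟨by simp, fqr⟩ ?_
  refine .arith ⟨by simp, fq⟩ ⟨by simp [e8], ft'⟩ ?_
  refine .arith ⟨by simp [e7], ft⟩ ⟨by simp, fqt⟩ ?_
  refine .arith ⟨by simp [e8], ft'⟩ ⟨by simp [e0], f0⟩ ?_
  refine .arith ⟨by simp, fu⟩ ⟨by simp [e3], fX⟩ ?_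
  refine .arith ⟨by simp, fd⟩ ⟨by simp [e3], fX⟩ ?_
  refine .arith ⟨by simp, fu⟩ ⟨by simp, fdX⟩ ?_
  refine .arith ⟨by simp [e6], fr'⟩ ⟨by simp [e0], f0⟩ ?_
  refine .arith ⟨by simp, fr2⟩ ⟨by simp [e0], f0⟩ ?_
  refine .nil ?_
  have hb : 2 * (r % r') ≤ r := two_mul_emod_le h hle'
  simp only [Op.eval_add, Op.eval_sub, Op.eval_mul, Op.eval_div, add_zero]
  rw [← hudef, hur, hr2]
  constructor
  · simp [hmem]
  · intro q hq
    simp only [State.setReg_reg]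
    rw [if_neg (by omega), if_neg (by omega), if_neg (by omega), if_neg (by omega),
      if_neg (by omega), if_neg (by omega), if_neg (by omega), if_neg (by omega),
      if_neg (by omega), if_neg (by omega), if_neg (by omega)]
    exact hreg q hq
  · simpa using h
  · simpa [eX] using hle'.trans hle
  · simpa using hm0
  · simpa using hm1.le
  · simp only [State.setReg_reg]
    norm_num
    rw [pow_succ] at hlt
    nlinarith
  · simpa [eX] using hc'
  · simpa [eX] using ⟨hu0, hu1.le⟩
  · simpa [eX, eY] using hdvd'
  · obtain ⟨c, hc⟩ := hdvd
    obtain ⟨c', hc'⟩ := hdvd'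
    simp only [State.setReg_reg]
    norm_num
    rw [eX, eY]
    refine ⟨c - r / r' * c' - u / X * Y, ?_⟩
    linear_combination hc - r / r' * hc' + Y * (hum + hudef) - hm
  · simp only [State.setReg_reg]
    norm_num
    rw [eX, eY, ← hgcd, Int.gcd_comm, Int.gcd_emod]

/-- What `euclid`, started in the state `s₀`, achieves. -/
structure EuclidPost (s₀ s : State) : Prop where
  mem : s.mem = s₀.mem
  reg : ∀ r, r < 5 ∨ 10 < r → s.reg r = s₀.reg r
  gcd_eq : s.reg 5 = Int.gcd (s₀.reg 3) (s₀.reg 4)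
  coeff : 0 ≤ s.reg 7 ∧ s.reg 7 ≤ s₀.reg 3
  dvd : s₀.reg 3 ∣ s.reg 7 * s₀.reg 4 - s.reg 5

theorem reaches_euclid {s : State} {k S : ℕ} (h0 : s.reg 0 = 0) (h3 : 0 < s.reg 3)
    (h3' : s.reg 3 < 2 ^ S) (h4 : 0 < s.reg 4) (h4' : s.reg 4 < 2 ^ S) (hk : 4 * S + 2 ≤ k) :
    Reaches k euclid s (26 * S + 8) (EuclidPost s) := by
  set N : ℤ := 2 ^ S with hN
  have hk : 4 * N ^ 2 ≤ 2 ^ k := by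
    rw [hN, ← pow_mul, show (4 : ℤ) = 2 ^ 2 by norm_num, ← pow_add]
    exact pow_le_pow_right₀ one_le_two (by omega)
  generalize e3 : s.reg 3 = X at *
  generalize e4 : s.reg 4 = Y at *
  have hN1 : 1 ≤ N := by omega
  have hNN : N ≤ N ^ 2 := by nlinarith
  have fits : ∀ z : ℤ, 0 ≤ z → z ≤ N → Fits k z := fun z hz hz' =>
    lt_of_lt_of_le (by rw [abs_of_nonneg hz]; linarith) hk
  have hm := Int.emod_add_mul_ediv Y X
  have hm0 := Int.emod_nonneg Y h3.ne'
  have hm1 := Int.emod_lt_of_pos Y h3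
  have hq0 : 0 ≤ Y / X := Int.ediv_nonneg h4.le h3.le
  have hq1 : Y / X ≤ Y := Int.ediv_le_self _ h4.le
  have hqX : 0 ≤ Y / X * X := mul_nonneg hq0 h3.le
  have hr : Y - Y / X * X = Y % X := by linear_combination -hm
  have f0 : Fits k 0 := fits_zero k
  have fX := fits X h3.le h3'.le
  have fY := fits Y h4.le h4'.le
  have fq := fits (Y / X) hq0 (by linarith)
  have fqX := fits (Y / X * X) hqX (by linarith)
  -- Both initial remainders are below `2 ^ S`, so `2 * S` rounds suffice, each costing `12` plus a
  -- test; the summands follow the block from its end.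
  have hrun : Reaches k euclid s (1 + (13 * (2 * S) + 1) + 1 + 1 + 1 + 1 + 1 + 1)
      fun s' => s'.reg 6 ≤ 0 ∧ ∃ j, EuclidInv s j s' := by
    refine .arith ⟨e3, fX⟩ ⟨h0, f0⟩ ?_
    refine .arith ⟨by simp [e4], fY⟩ ⟨by simp [e3], fX⟩ ?_
    refine .arith ⟨by simp, fq⟩ ⟨by simp [e3], fX⟩ ?_
    refine .arith ⟨by simp [e4], fY⟩ ⟨by simp, fqX⟩ ?_
    refine .arith ⟨by simp [h0], f0⟩ ⟨by simp [h0], f0⟩ ?_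
    refine .const (fits 1 zero_le_one hN1) ?_
    refine .cons (reaches_whilePos (Inv := EuclidInv s) (fun j s' hs' => ?_)
      (fun j s' hs' h => reaches_euclidStep h0 (by rwa [e3]) hk hs' h) (2 * S) _ ?_)
      fun s' hs' => .nil hs'
    · exact fits _ hs'.nonneg (by have := hs'.le; have := hs'.le'; omega)
    · constructor
      · simp
      · intro q hq
        simp only [State.setReg_reg]
        rw [if_neg (by omega), if_neg (by omega), if_neg (by omega), if_neg (by omega),
          if_neg (by omega), if_neg (by omega)]
      · simpa using h3
      · simp [e3]
      · simpa [hr] using hm0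
      · simpa [hr] using hm1.le
      · simp only [State.setReg_reg]
        norm_num
        rw [hr, two_mul, pow_add, ← hN]
        nlinarith
      · simpa [e3] using h3.le
      · simpa [e3] using Int.add_one_le_of_lt h3
      · simp [e3]
      · refine ⟨Y / X, ?_⟩
        simp [e3, e4, mul_comm]
      · simp only [State.setReg_reg]
        norm_num
        rw [e3, e4]
  refine hrun.mono (by omega) ?_
  rintro s' ⟨h6, j, hs'⟩
  refine ⟨hs'.mem, hs'.reg, ?_, hs'.coeff, hs'.dvd⟩
  rw [← hs'.gcd_eq, le_antisymm h6 hs'.nonneg, Int.gcd_zero_right, Int.natAbs_of_nonneg hs'.pos.le]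

end RAM

/-! ### The solver and its two loops. -/

namespace RAM

open Knapsack

/-- The fourth power covers a Bézout coefficient times a right-hand side of cubic size. -/
theorem fits_of_abs_le {S k : ℕ} (hk : 4 * S + 2 ≤ k) {z : ℤ} (hz : |z| ≤ 3 * (2 ^ S) ^ 4) :
    Fits k z := by
  have h1 : (4 : ℤ) * (2 ^ S) ^ 4 ≤ 2 ^ k := by
    rw [← pow_mul, show (4 : ℤ) = 2 ^ 2 by norm_num, ← pow_add]
    exact pow_le_pow_right₀ one_le_two (by omega)
  have h2 : (0 : ℤ) < (2 ^ S) ^ 4 := by positivity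
  exact lt_of_lt_of_le (by linarith) h1

theorem fits_of_abs_le_two_pow {S k : ℕ} (hk : 4 * S + 2 ≤ k) {z : ℤ} (hz : |z| ≤ 2 ^ S) :
    Fits k z := by
  have h1 : (1 : ℤ) ≤ 2 ^ S := one_le_pow₀ one_le_two
  have h2 : (2 : ℤ) ^ S ≤ (2 ^ S) ^ 4 := le_self_pow₀ h1 (by norm_num)
  exact fits_of_abs_le hk (by linarith)

/-- Append the greatest common divisor of the next prefix to the list of those of the shorter
prefixes, which is kept in the cells with negative addresses. -/
def gcdStep : Prog := .block
  [.arith .add 12 12 1, .load 4 12, euclid, .arith .add 3 5 0, .arith .sub 14 0 12, .store 14 3,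
   .arith .sub 13 2 12]

/-- Replace the last remaining entry of the row vector by its digit, and subtract its contribution
from the right-hand side, which is kept in register `11`. -/
def digitStep : Prog := .block
  [.arith .sub 14 0 13, .load 3 14, .load 4 12, euclid,
   -- Register `9` becomes the digit of `dvd_sub_mul_digit`; the remainder is formed by multiplying
   -- the quotient back.
   .arith .div 9 11 5, .arith .mul 9 7 9, .arith .div 10 3 5,
   .arith .div 14 9 10, .arith .mul 14 14 10, .arith .sub 9 9 14,
   .store 12 9, .arith .mul 14 4 9, .arith .sub 11 11 14,
   .arith .add 12 13 0, .arith .sub 13 12 1]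

/-- The program that computes the integer solution in the Hermite box. -/
def solve : Prog := .block
  -- Cell `0` is lowered by one, as the output has no entry for `b`; the solution then replaces the
  -- row vector in place.
  [.const 1 1, .load 2 0, .load 11 2, .arith .sub 2 2 1, .store 0 2,
   .arith .add 12 1 0, .load 3 1, .arith .sub 14 0 12, .store 14 3, .arith .sub 13 2 12,
   .whilePos 13 gcdStep, .arith .sub 13 12 1, .whilePos 13 digitStep,
   .load 3 1, .arith .div 11 11 3, .store 1 11]

/-- The row vector `a 0, …, a d` and the right-hand side `b` have entries below `2 ^ S`. -/
structure Bounded (a : ℕ → ℤ) (b : ℤ) (d S : ℕ) : Prop where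
  pos : ∀ k, 0 < a k
  lt : ∀ k ≤ d, a k < 2 ^ S
  rhs : |b| < 2 ^ S
  length : (d : ℤ) + 2 ≤ 2 ^ S

theorem Bounded.gcdSeq_lt {a : ℕ → ℤ} {b : ℤ} {d S : ℕ} (h : Bounded a b d S) (k : ℕ) :
    gcdSeq a k < 2 ^ S :=
  (Int.le_of_dvd (h.pos 0) (gcdSeq_dvd_entry a (Nat.zero_le k))).trans_lt (h.lt 0 (Nat.zero_le d))

/-- The invariant of the loop over `gcdStep`: `q` entries are processed, `i` entries remain. -/
structure GcdInv (a : ℕ → ℤ) (b : ℤ) (d q i : ℕ) (s : State) : Prop where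
  add_eq : q + i = d
  reg0 : s.reg 0 = 0
  reg1 : s.reg 1 = 1
  reg2 : s.reg 2 = d + 1
  reg3 : s.reg 3 = gcdSeq a q
  reg11 : s.reg 11 = b
  reg12 : s.reg 12 = q + 1
  reg13 : s.reg 13 = i
  length : s.mem 0 = d + 1
  entries : ∀ k ≤ d, s.mem ((k : ℤ) + 1) = a k
  gcds : ∀ k ≤ q, s.mem (-((k : ℤ) + 1)) = gcdSeq a k

/-- The invariant of the loop over `digitStep`: `i` digits remain. -/
structure DigitInv (a : ℕ → ℤ) (b : ℤ) (d S i : ℕ) (s : State) : Prop where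
  le : i ≤ d
  reg0 : s.reg 0 = 0
  reg1 : s.reg 1 = 1
  reg12 : s.reg 12 = i + 1
  reg13 : s.reg 13 = i
  length : s.mem 0 = d + 1
  entries : ∀ k ≤ i, s.mem ((k : ℤ) + 1) = a k
  gcds : ∀ k ≤ d, s.mem (-((k : ℤ) + 1)) = gcdSeq a k
  digits : ∀ k, i ≤ k → k < d → 0 ≤ s.mem ((k : ℤ) + 2) ∧
    s.mem ((k : ℤ) + 2) < gcdSeq a k / gcdSeq a (k + 1)
  rest : s.reg 11 = b - ∑ k ∈ Finset.Ico i d, a (k + 1) * s.mem ((k : ℤ) + 2)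
  dvd : gcdSeq a i ∣ s.reg 11
  -- Each round subtracts an entry times a digit, at most `(2 ^ S) ^ 2`, so growth is linear in the
  -- number of rounds.
  bound : |s.reg 11| ≤ 2 ^ S + (d - i) * (2 ^ S) ^ 2

/-- The gcd is stored at a negative address, so it cannot overwrite the length or the entries. -/
theorem reaches_gcdStep {a : ℕ → ℤ} {b : ℤ} {d S k q i : ℕ} {s : State} (h : Bounded a b d S)
    (hk : 4 * S + 2 ≤ k) (hs : GcdInv a b d q (i + 1) s) :
    Reaches k gcdStep s (26 * S + 17) (GcdInv a b d (q + 1) i) := by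
  obtain ⟨hadd, h0, h1, h2, h3, h11, h12, h13, hlen, hent, hgcd⟩ := hs
  have hN := h.length
  have fits : ∀ z : ℤ, |z| ≤ 2 ^ S → Fits k z := fun z => fits_of_abs_le_two_pow hk
  have hqd : (q : ℤ) + 1 + i = d := by rw [← hadd]; push_cast; ring
  have hY : s.mem ((q : ℤ) + 1 + 1) = a (q + 1) := by
    simpa using hent (q + 1) (by omega)
  have hYp := h.pos (q + 1)
  have hYl := h.lt (q + 1) (by omega)
  have hXp := gcdSeq_pos h.pos q
  have hXl := h.gcdSeq_lt q
  have hgp := gcdSeq_pos h.pos (q + 1)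
  have hgl := h.gcdSeq_lt (q + 1)
  have f0 : Fits k 0 := fits_zero k
  have f1 : Fits k 1 := fits _ (by rw [abs_le]; constructor <;> omega)
  have fq : Fits k ((q : ℤ) + 1) := fits _ (by rw [abs_le]; constructor <;> omega)
  have fq' : Fits k ((q : ℤ) + 1 + 1) := fits _ (by rw [abs_le]; constructor <;> omega)
  have fqn : Fits k (0 - ((q : ℤ) + 1 + 1)) := fits _ (by rw [abs_le]; constructor <;> omega)
  have fd : Fits k ((d : ℤ) + 1) := fits _ (by rw [abs_le]; constructor <;> omega)
  have fY : Fits k (a (q + 1)) := fits _ (by rw [abs_le]; constructor <;> omega)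
  have fg : Fits k (gcdSeq a (q + 1)) := fits _ (by rw [abs_le]; constructor <;> omega)
  have hrun : Reaches k gcdStep s (6 + (26 * S + 8) + 2 + 1) (GcdInv a b d (q + 1) i) := by
    refine .arith ⟨h12, fq⟩ ⟨h1, f1⟩ ?_
    refine .load ⟨by simp, fq'⟩ ⟨by simpa using hY, fY⟩ ?_
    refine .cons (reaches_euclid (S := S) (by simpa using h0) (by simpa [h3] using hXp)
      (by simpa [h3] using hXl) (by simpa using hYp) (by simpa using hYl) hk) fun s' hs' => ?_
    have e5 : s'.reg 5 = gcdSeq a (q + 1) := by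
      rw [hs'.gcd_eq]
      simp [h3, gcdSeq]
    have e0 : s'.reg 0 = 0 := by rw [hs'.reg 0 (by omega)]; simpa using h0
    have e1 : s'.reg 1 = 1 := by rw [hs'.reg 1 (by omega)]; simpa using h1
    have e2 : s'.reg 2 = d + 1 := by rw [hs'.reg 2 (by omega)]; simpa using h2
    have e11 : s'.reg 11 = b := by rw [hs'.reg 11 (by omega)]; simpa using h11
    have e12 : s'.reg 12 = (q : ℤ) + 1 + 1 := by rw [hs'.reg 12 (by omega)]; simp
    have em : s'.mem = s.mem := by rw [hs'.mem]; simp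
    clear hs'
    refine .arith ⟨e5, fg⟩ ⟨e0, f0⟩ ?_
    refine .arith ⟨by simpa using e0, f0⟩ ⟨by simpa using e12, fq'⟩ ?_
    refine .store ⟨by simp, fqn⟩ ⟨by simp, fg⟩ ?_
    refine .arith ⟨by simpa using e2, fd⟩ ⟨by simpa using e12, fq'⟩ ?_
    refine .nil ⟨by omega, ?_, ?_, ?_, ?_, ?_, ?_, ?_, ?_, ?_, ?_⟩
    · simpa using e0
    · simpa using e1
    · simpa using e2
    · simp
    · simpa using e11
    · simpa using e12
    · simp only [State.setReg_reg, if_true, Op.eval_sub]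
      omega
    · simp only [State.setReg_mem, State.setMem_mem, em]
      rw [if_neg (by omega), hlen]
    · intro j hj
      simp only [State.setReg_mem, State.setMem_mem, em]
      rw [if_neg (by omega), hent j hj]
    · intro j hj
      simp only [State.setReg_mem, State.setMem_mem, em]
      split_ifs with hjq
      · rw [show j = q + 1 by omega]
      · exact hgcd j (by omega)
  exact hrun.mono (by omega) fun _ => id

set_option maxHeartbeats 800000 in
theorem reaches_digitStep {a : ℕ → ℤ} {b : ℤ} {d S k i : ℕ} {s : State} (h : Bounded a b d S)
    (hk : 4 * S + 2 ≤ k) (hs : DigitInv a b d S (i + 1) s) :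
    Reaches k digitStep s (26 * S + 26) (DigitInv a b d S i) := by
  obtain ⟨hle, h0, h1, h12, h13, hlen, hent, hgcd, hdig, hrest, hdvd, hbound⟩ := hs
  have hN := h.length
  have fits : ∀ z : ℤ, |z| ≤ 2 ^ S → Fits k z := fun z => fits_of_abs_le_two_pow hk
  have hX : s.mem (0 - ((i : ℤ) + 1)) = gcdSeq a i := by
    rw [zero_sub]; exact hgcd i (by omega)
  have hY : s.mem ((i : ℤ) + 1 + 1) = a (i + 1) := by
    simpa using hent (i + 1) (by omega)
  push_cast at h12 h13 hbound
  have hYp := h.pos (i + 1)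
  have hYl := h.lt (i + 1) (by omega)
  have hXp := gcdSeq_pos h.pos i
  have hXl := h.gcdSeq_lt i
  have hgp := gcdSeq_pos h.pos (i + 1)
  have hmp := gcdSeq_quotient_pos h.pos i
  have hgX := gcdSeq_succ_dvd a i
  have hgY := gcdSeq_dvd a (i + 1)
  have hgl := h.gcdSeq_lt (i + 1)
  have hgdef : gcdSeq a (i + 1) = Int.gcd (gcdSeq a i) (a (i + 1)) := rfl
  have hcast : ((i + 1 : ℕ) : ℤ) = i + 1 := by push_cast; rfl
  have hle' : (i : ℤ) + 1 ≤ d := by exact_mod_cast hle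
  generalize eX : gcdSeq a i = X at *
  generalize eY : a (i + 1) = Y at *
  generalize eg : gcdSeq a (i + 1) = g at *
  generalize ec : s.reg 11 = c at *
  generalize eN : (2 : ℤ) ^ S = N at *
  have hN2 : N ≤ N ^ 2 := by nlinarith
  -- Here `d ≤ N` turns the linear growth into a cubic bound.
  have hc3 : |c| ≤ 2 * N ^ 3 := by
    have : ((d : ℤ) - (i + 1)) * N ^ 2 ≤ (N - 1) * N ^ 2 :=
      mul_le_mul_of_nonneg_right (by omega) (sq_nonneg N)
    have h3 : N ^ 2 ≤ N ^ 3 := pow_le_pow_right₀ (by omega) (by norm_num)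
    nlinarith
  have hN3 : N ^ 3 ≤ N ^ 4 := pow_le_pow_right₀ (by omega) (by norm_num)
  have hN4 : N ^ 2 ≤ N ^ 3 := pow_le_pow_right₀ (by omega) (by norm_num)
  have fits' : ∀ z : ℤ, |z| ≤ 3 * N ^ 4 → Fits k z := by
    rw [← eN]; exact fun z => fits_of_abs_le hk
  have hmX : X / g ≤ X := Int.ediv_le_self _ hXp.le
  have f0 : Fits k 0 := fits_zero k
  have f1 : Fits k 1 := fits _ (by rw [abs_le]; constructor <;> omega)
  have fi : Fits k ((i : ℤ) + 1) := fits _ (by rw [abs_le]; constructor <;> omega)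
  have fi' : Fits k ((i : ℤ) + 1 + 1) := fits _ (by rw [abs_le]; constructor <;> omega)
  have fin : Fits k (0 - ((i : ℤ) + 1)) := fits _ (by rw [abs_le]; constructor <;> omega)
  have fX : Fits k X := fits _ (by rw [abs_le]; constructor <;> omega)
  have fY : Fits k Y := fits _ (by rw [abs_le]; constructor <;> omega)
  have fg : Fits k g := fits _ (by rw [abs_le]; constructor <;> omega)
  have fm : Fits k (X / g) := fits _ (by rw [abs_le]; constructor <;> omega)
  have fc : Fits k c := fits' _ (by linarith)
  have hrun : Reaches k digitStep s (13 + (26 * S + 8) + 2 + 2 + 1) (DigitInv a b d S i) := by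
    refine .arith ⟨h0, f0⟩ ⟨h13, fi⟩ ?_
    refine .load ⟨by simp, fin⟩ ⟨by simpa using hX, fX⟩ ?_
    refine .load ⟨by simpa using h12, fi'⟩ ⟨by simpa using hY, fY⟩ ?_
    refine .cons (reaches_euclid (S := S) (by simpa using h0) (by simpa using hXp)
      (by simpa [eN] using hXl) (by simpa using hYp) (by simpa [eN] using hYl) hk) fun s' hs' => ?_
    have e5 : s'.reg 5 = g := by
      rw [hs'.gcd_eq, hgdef]
      simp
    have e0 : s'.reg 0 = 0 := by rw [hs'.reg 0 (by omega)]; simpa using h0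
    have e1 : s'.reg 1 = 1 := by rw [hs'.reg 1 (by omega)]; simpa using h1
    have e3 : s'.reg 3 = X := by rw [hs'.reg 3 (by omega)]; simp
    have e4 : s'.reg 4 = Y := by rw [hs'.reg 4 (by omega)]; simp
    have e11 : s'.reg 11 = c := by rw [hs'.reg 11 (by omega)]; simpa using ec
    have e12 : s'.reg 12 = (i : ℤ) + 1 + 1 := by rw [hs'.reg 12 (by omega)]; simpa using h12
    have e13 : s'.reg 13 = (i : ℤ) + 1 := by rw [hs'.reg 13 (by omega)]; simpa using h13
    have em : s'.mem = s.mem := by rw [hs'.mem]; simp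
    have ht0 : 0 ≤ s'.reg 7 := hs'.coeff.1
    have ht1 : s'.reg 7 ≤ X := by simpa using hs'.coeff.2
    have htd : X ∣ s'.reg 7 * Y - g := by
      have := hs'.dvd
      rw [e5] at this
      simpa using this
    clear hs'
    generalize e7 : s'.reg 7 = t at *
    have he : |c / g| ≤ 2 * N ^ 3 := (Int.abs_ediv_le_abs _ _).trans hc3
    have hv : |t * (c / g)| ≤ 2 * N ^ 4 := by
      rw [abs_mul, abs_of_nonneg ht0]
      have := mul_le_mul (show t ≤ N by omega) he (abs_nonneg _) (by omega)
      linarith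
    have hvm := Int.emod_add_mul_ediv (t * (c / g)) (X / g)
    have hw0 := Int.emod_nonneg (t * (c / g)) hmp.ne'
    have hw1 := Int.emod_lt_of_pos (t * (c / g)) hmp
    have hnew : X ∣ c - Y * (t * (c / g) % (X / g)) := dvd_sub_mul_digit hgX hgY htd hdvd
    have hwe : t * (c / g) - t * (c / g) / (X / g) * (X / g) = t * (c / g) % (X / g) := by
      linear_combination -hvm
    have hYw0 := mul_nonneg hYp.le hw0
    have hYw1 : Y * (t * (c / g) % (X / g)) ≤ N ^ 2 := by
      rw [sq]; exact mul_le_mul hYl.le (by omega) hw0 (by omega)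
    have hnewb : |c - Y * (t * (c / g) % (X / g))| ≤ N + ((d : ℤ) - i) * N ^ 2 := by
      rw [show N + ((d : ℤ) - i) * N ^ 2 = N + ((d : ℤ) - (i + 1)) * N ^ 2 + N ^ 2 by ring]
      rw [abs_le] at hbound ⊢
      constructor <;> linarith
    have ft : Fits k t := fits _ (by rw [abs_le]; constructor <;> omega)
    have fe : Fits k (c / g) := fits' _ (by linarith)
    have fv : Fits k (t * (c / g)) := fits' _ (by linarith)
    have fvd : Fits k (t * (c / g) / (X / g)) :=
      fits' _ ((Int.abs_ediv_le_abs _ _).trans (by linarith))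
    have fvm : Fits k (t * (c / g) / (X / g) * (X / g)) := fits' _ (by
      rw [abs_le] at hv ⊢; constructor <;> linarith)
    have fw : Fits k (t * (c / g) % (X / g)) := fits _ (by rw [abs_le]; constructor <;> omega)
    have fYw : Fits k (Y * (t * (c / g) % (X / g))) := fits' _ (by
      rw [abs_le]; constructor <;> linarith)
    refine .arith ⟨e11, fc⟩ ⟨e5, fg⟩ ?_
    refine .arith ⟨by simpa using e7, ft⟩ ⟨by simp, fe⟩ ?_
    refine .arith ⟨by simpa using e3, fX⟩ ⟨by simpa using e5, fg⟩ ?_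
    refine .arith ⟨by simp, fv⟩ ⟨by simp, fm⟩ ?_
    refine .arith ⟨by simp, fvd⟩ ⟨by simp, fm⟩ ?_
    refine .arith ⟨by simp, fv⟩ ⟨by simp, fvm⟩ ?_
    refine .store ⟨by simpa using e12, fi'⟩ ⟨by simpa using hwe, fw⟩ ?_
    refine .arith ⟨by simpa using e4, fY⟩ ⟨by simpa using hwe, fw⟩ ?_
    refine .arith ⟨by simpa using e11, fc⟩ ⟨by simp, fYw⟩ ?_
    refine .arith ⟨by simpa using e13, fi⟩ ⟨by simpa using e0, f0⟩ ?_
    refine .arith ⟨by simp, fi⟩ ⟨by simpa using e1, f1⟩ ?_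
    generalize t * (c / g) % (X / g) = w at *
    refine .nil ⟨by omega, ?_, ?_, ?_, ?_, ?_, ?_, ?_, ?_, ?_, ?_, ?_⟩
    · simpa using e0
    · simpa using e1
    · simp
    · simp
    · simp only [State.setReg_mem, State.setMem_mem, em]
      rw [if_neg (by omega), hlen]
    · intro j hj
      simp only [State.setReg_mem, State.setMem_mem, em]
      rw [if_neg (by omega), hent j (by omega)]
    · intro j hj
      simp only [State.setReg_mem, State.setMem_mem, em]
      rw [if_neg (by omega), hgcd j hj]
    · intro j hj hjd
      simp only [State.setReg_mem, State.setMem_mem, em]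
      split_ifs with hji
      · obtain rfl : j = i := by omega
        rw [eX, eg]
        exact ⟨hw0, hw1⟩
      · exact hdig j (by omega) hjd
    · simp only [State.setReg_mem, State.setMem_mem, em]
      -- Only cell `i + 2` has changed, from an entry to its digit, so a single new summand splits
      -- off.
      rw [Finset.sum_eq_sum_Ico_succ_bot (by omega), if_pos (by omega), eY,
        Finset.sum_congr rfl (g := fun j => a (j + 1) * s.mem ((j : ℤ) + 2))]
      · simp [hrest]
        ring
      · intro j hj
        have := (Finset.mem_Ico.1 hj).1
        rw [if_neg (by omega)]
    · rw [eX]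
      simpa using hnew
    · simp only [State.setReg_reg]
      norm_num
      rw [eN]
      exact hnewb
  exact hrun.mono (by omega) fun _ => id

/-- The cells `1, …, d + 1` hold the digits that solve the equation. -/
structure Solved (a : ℕ → ℤ) (b : ℤ) (d : ℕ) (s : State) : Prop where
  length : s.mem 0 = d + 1
  digits : ∀ k < d, 0 ≤ s.mem ((k : ℤ) + 2) ∧
    s.mem ((k : ℤ) + 2) < gcdSeq a k / gcdSeq a (k + 1)
  sum_eq : a 0 * s.mem 1 + ∑ k ∈ Finset.range d, a (k + 1) * s.mem ((k : ℤ) + 2) = b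

theorem reaches_solve {a : ℕ → ℤ} {b : ℤ} {d S k : ℕ} {s : State} (h : Bounded a b d S)
    (hb : gcdSeq a d ∣ b) (hk : 4 * S + 2 ≤ k) (hreg : ∀ r, s.reg r = 0) (hlen : s.mem 0 = d + 2)
    (hent : ∀ k ≤ d, s.mem ((k : ℤ) + 1) = a k) (hrhs : s.mem ((d : ℤ) + 2) = b) :
    Reaches k solve s ((26 * S + 27) * d + (26 * S + 18) * d + 24) (Solved a b d) := by
  have hN := h.length
  have hbl := h.rhs
  have fits : ∀ z : ℤ, |z| ≤ 2 ^ S → Fits k z := fun z => fits_of_abs_le_two_pow hk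
  have h0p := h.pos 0
  have h0l := h.lt 0 (by omega)
  have hent0 : s.mem 1 = a 0 := by simpa using hent 0 (by omega)
  have f0 : Fits k 0 := fits_zero k
  have f1 : Fits k 1 := fits _ (by rw [abs_le]; constructor <;> omega)
  have fn : Fits k (-1) := fits _ (by rw [abs_le]; constructor <;> omega)
  have fd1 : Fits k ((d : ℤ) + 1) := fits _ (by rw [abs_le]; constructor <;> omega)
  have fd2 : Fits k ((d : ℤ) + 2) := fits _ (by rw [abs_le]; constructor <;> omega)
  have fa : Fits k (a 0) := fits _ (by rw [abs_le]; constructor <;> omega)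
  have fb : Fits k b := fits _ hbl.le
  have hrun : Reaches k solve s (6 + ((26 * S + 26 + 1) * d + 1) + 1 +
      ((26 * S + 17 + 1) * d + 1) + 1 + 2 + 1 + 2 + 1 + 2 + 1 + 2 + 2 + 1) (Solved a b d) := by
    refine .const f1 ?_
    refine .load ⟨by simpa using hreg 0, f0⟩ ⟨by simpa using hlen, fd2⟩ ?_
    refine .load ⟨by simp, fd2⟩ ⟨by simpa using hrhs, fb⟩ ?_
    refine .arith ⟨by simp, fd2⟩ ⟨by simp, f1⟩ ?_
    refine .store ⟨by simpa using hreg 0, f0⟩ ⟨by simp; ring, fd1⟩ ?_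
    refine .arith ⟨by simp, f1⟩ ⟨by simpa using hreg 0, f0⟩ ?_
    refine .load ⟨by simp, f1⟩ ⟨by simpa using hent0, fa⟩ ?_
    refine .arith ⟨by simpa using hreg 0, f0⟩ ⟨by simp, f1⟩ ?_
    refine .store ⟨by simp, fn⟩ ⟨by simp, fa⟩ ?_
    refine .arith ⟨by simp; ring, fd1⟩ ⟨by simp, f1⟩ ?_
    -- The loop rule counts the remaining entries; the number `q` of processed ones starts at `0`
    -- and is hidden by the quantifier.
    refine .cons (reaches_whilePos (Inv := fun i s => ∃ q, GcdInv a b d q i s) (c := 26 * S + 17)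
      ?_ ?_ d _ ⟨0, ?_⟩) ?_
    · rintro j s' ⟨q, hs'⟩
      have := hs'.add_eq
      rw [hs'.reg13]
      exact fits _ (by rw [abs_le]; constructor <;> omega)
    · rintro j s' ⟨q, hs'⟩ hj
      rw [hs'.reg13] at hj
      obtain ⟨j, rfl⟩ := Nat.exists_eq_succ_of_ne_zero (show j ≠ 0 by omega)
      exact ⟨j, rfl, (reaches_gcdStep h hk hs').mono le_rfl fun _ hs => ⟨_, hs⟩⟩
    · constructor
      · omega
      · simpa using hreg 0
      · simp
      · simp; ring
      · simp [gcdSeq]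
      · simp
      · simp
      · simp
      · simp
      · intro j hj
        simp only [State.setReg_mem, State.setMem_mem, Op.eval_sub]
        rw [if_neg (by omega), if_neg (by omega), hent j hj]
      · intro j hj
        obtain rfl : j = 0 := by omega
        simp [gcdSeq]
    · rintro s₁ ⟨hs₁, j, q, inv⟩
      have hadd := inv.add_eq
      rw [inv.reg13] at hs₁
      obtain rfl : j = 0 := by omega
      obtain rfl : q = d := by omega
      refine .arith ⟨inv.reg12, fd1⟩ ⟨inv.reg1, f1⟩ ?_
      refine .cons (reaches_whilePos (Inv := DigitInv a b q S) (c := 26 * S + 26) ?_ ?_ q _ ?_) ?_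
      · intro j s' hs'
        have := hs'.le
        rw [hs'.reg13]
        exact fits _ (by rw [abs_le]; constructor <;> omega)
      · intro j s' hs' hj
        rw [hs'.reg13] at hj
        obtain ⟨j, rfl⟩ := Nat.exists_eq_succ_of_ne_zero (show j ≠ 0 by omega)
        exact ⟨j, rfl, reaches_digitStep h hk hs'⟩
      · constructor
        · rfl
        · simpa using inv.reg0
        · simpa using inv.reg1
        · simpa using inv.reg12
        · simp
        · simpa using inv.length
        · simpa using inv.entries
        · simpa using inv.gcds
        · intro j hj hj'
          omega
        · simpa using inv.reg11
        · simpa [inv.reg11] using hb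
        · simpa [inv.reg11] using hbl.le
      · rintro s₂ ⟨hs₂, j, inv₂⟩
        rw [inv₂.reg13] at hs₂
        obtain rfl : j = 0 := by omega
        have hfit : Fits k (s₂.reg 11) := by
          refine fits_of_abs_le hk (inv₂.bound.trans ?_)
          push_cast
          generalize (2 : ℤ) ^ S = N at *
          have h1 : N ≤ N ^ 4 := le_self_pow₀ (by omega) (by norm_num)
          have h2 : N ^ 3 ≤ N ^ 4 := pow_le_pow_right₀ (by omega) (by norm_num)
          have h3 : (q : ℤ) * N ^ 2 ≤ N * N ^ 2 :=
            mul_le_mul_of_nonneg_right (by omega) (sq_nonneg N)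
          nlinarith
        have hdvd : a 0 ∣ s₂.reg 11 := inv₂.dvd
        have hfit' : Fits k (s₂.reg 11 / a 0) :=
          (Int.abs_ediv_le_abs _ _).trans_lt hfit
        refine .load ⟨inv₂.reg1, f1⟩ ⟨by simpa using inv₂.entries 0 le_rfl, fa⟩ ?_
        refine .arith ⟨by simp, hfit⟩ ⟨by simp, fa⟩ ?_
        refine .store ⟨by simpa using inv₂.reg1, f1⟩ ⟨by simp, hfit'⟩ ?_
        refine .nil ⟨?_, ?_, ?_⟩
        · simpa using inv₂.length
        · intro j hj
          simp only [State.setReg_mem, State.setMem_mem]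
          rw [if_neg (by omega)]
          exact inv₂.digits j (Nat.zero_le j) hj
        · simp only [State.setReg_mem, State.setMem_mem, if_true]
          have hne : ∀ j : ℕ, (j : ℤ) + 2 ≠ 1 := fun j => by omega
          simp only [hne, if_false]
          rw [Int.mul_ediv_cancel' hdvd, inv₂.rest, Finset.range_eq_Ico]
          ring
  refine hrun.mono ?_ fun _ => id
  ring_nf
  rfl

end RAM

/-! ### Encoding length and the polynomial bound. -/

namespace RAM

open Knapsack

theorem abs_lt_two_pow_inputSize {l : List ℤ} {z : ℤ} (hz : z ∈ l) : |z| < 2 ^ inputSize l := by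
  have h1 : bitLen z ≤ inputSize l := List.le_sum_of_mem (List.mem_map_of_mem hz)
  have h2 : z.natAbs < 2 ^ inputSize l :=
    Nat.size_le.1 ((Nat.le_succ _).trans h1)
  rw [Int.abs_eq_natAbs]
  exact_mod_cast h2

/-- Every entry, even `0`, contributes its sign bit. Thus the encoding length bounds the number of
rounds and the addresses. -/
theorem length_le_inputSize (l : List ℤ) : l.length ≤ inputSize l := by
  rw [← List.length_map (f := bitLen)]
  refine List.length_le_sum_of_one_le _ fun n hn => ?_
  obtain ⟨z, -, rfl⟩ := List.mem_map.1 hn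
  exact Nat.succ_le_succ (Nat.zero_le _)

theorem inputState_mem_succ (l : List ℤ) (j : ℕ) :
    (inputState l).mem ((j : ℤ) + 1) = l.getD j 0 := by
  simp only [inputState]
  rw [if_neg (by omega), if_pos (by omega)]
  congr 1

theorem bounded_input {d : ℕ} {a : Fin (d + 1) → ℤ} (b : ℤ) (ha : ∀ i, 0 < a i) :
    Bounded (extend a) b d (inputSize (List.ofFn a ++ [b])) where
  pos := extend_pos ha
  lt j hj := by
    have : extend a j = a ⟨j, by omega⟩ := extend_val a ⟨j, by omega⟩
    rw [this]
    exact (le_abs_self _).trans_lt (abs_lt_two_pow_inputSize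
      (List.mem_append_left _ (List.mem_ofFn.2 ⟨_, rfl⟩)))
  rhs := abs_lt_two_pow_inputSize (by simp)
  length := by
    have h1 := length_le_inputSize (List.ofFn a ++ [b])
    have h2 := Nat.lt_two_pow_self (n := inputSize (List.ofFn a ++ [b]))
    simp only [List.length_append, List.length_ofFn, List.length_singleton] at h1
    exact_mod_cast (show d + 2 ≤ _ by omega)

theorem Solved.spec {d : ℕ} {a : Fin (d + 1) → ℤ} {b : ℤ} {s : State}
    (hs : Solved (extend a) b d s) {x : Fin (d + 1) → ℤ} (hx : ∀ i, x i = s.mem ((i : ℤ) + 1)) :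
    IsOutput s (List.ofFn x) ∧ ∑ i, a i * x i = b ∧
      ∀ i : Fin d, 0 ≤ x i.succ ∧
        x i.succ < gcdSeq (extend a) i / gcdSeq (extend a) (i + 1) := by
  have hsucc : ∀ i : Fin d, x i.succ = s.mem (((i : ℕ) : ℤ) + 2) := by
    intro i
    rw [hx, Fin.val_succ]
    push_cast
    ring_nf
  refine ⟨⟨by simp [hs.length], fun i hi => ?_⟩, ?_, fun i => ?_⟩
  · rw [List.length_ofFn] at hi
    rw [List.getD_eq_getElem _ _ (by simpa using hi), List.getElem_ofFn, hx]
  · rw [← hs.sum_eq, Fin.sum_univ_succ]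
    simp_rw [hsucc]
    rw [sum_succ_eq_sum_range a fun j => s.mem ((j : ℤ) + 2), hx, ← extend_val a 0]
    simp
  · rw [hsucc]
    exact hs.digits i i.is_lt

open Polynomial in
/-- A polynomial bound for the number of bit operations of `solve`. -/
noncomputable def costPoly : Polynomial ℕ := ((52 * X + 45) * X + 24) * (4 * X + 3) ^ 2

theorem exists_outputsWithin_solve {d : ℕ} {a : Fin (d + 1) → ℤ} (b : ℤ) (ha : ∀ i, 0 < a i)
    (h1 : Finset.univ.gcd a = 1) :
    ∃ x : Fin (d + 1) → ℤ,
      OutputsWithin solve (List.ofFn a ++ [b]) (List.ofFn x)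
        (costPoly.eval (inputSize (List.ofFn a ++ [b]))) ∧
      ∑ i, a i * x i = b ∧ ∀ i : Fin d, 0 ≤ x i.succ ∧
        x i.succ < gcdSeq (extend a) i / gcdSeq (extend a) (i + 1) := by
  have hlen := length_le_inputSize (List.ofFn a ++ [b])
  simp only [List.length_append, List.length_ofFn, List.length_singleton] at hlen
  obtain ⟨t, s, hexec, ht, hs⟩ := reaches_solve (s := inputState (List.ofFn a ++ [b]))
    (bounded_input b ha) (by rw [gcdSeq_extend_last ha h1]; exact one_dvd b) le_rfl
    (fun _ => rfl) (by simp [inputState]; ring)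
    (fun j hj => by
      rw [inputState_mem_succ, List.getD_append _ _ _ _ (by simpa using by omega),
        List.getD_eq_getElem _ _ (by simpa using by omega), List.getElem_ofFn]
      exact (extend_val a ⟨j, by omega⟩).symm)
    (by
      have := inputState_mem_succ (List.ofFn a ++ [b]) (d + 1)
      rw [List.getD_append_right _ _ _ _ (by simp)] at this
      push_cast at this
      rw [add_assoc] at this
      simpa using this)
  generalize hS : inputSize (List.ofFn a ++ [b]) = S at *
  obtain ⟨hout, hsum, hdig⟩ := hs.spec (x := fun i => s.mem ((i : ℤ) + 1)) fun _ => rfl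
  refine ⟨_, ⟨s, t, hexec, ht.trans ?_, hout⟩, hsum, hdig⟩
  -- The coefficients `52` and `45` add up those of the two loops, and `4 * S + 2` is the bit width
  -- `k`; the count is then bounded using `d ≤ S`.
  have heval : costPoly.eval S = ((52 * S + 45) * S + 24) * (4 * S + 2 + 1) ^ 2 := by
    simp [costPoly]
  rw [heval]
  refine Nat.mul_le_mul_right _ ?_
  have := Nat.mul_le_mul_left (52 * S + 45) (show d ≤ S by omega)
  nlinarith

end RAM

theorem corollary1 :
    (∃ (P : RAM.Prog) (p : Polynomial ℕ), ∀ (d : ℕ) (a : Fin (d + 1) → ℤ) (b : ℤ),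
      (∀ i, 0 < a i) → Finset.univ.gcd a = 1 →
      ∃ x : Fin (d + 1) → ℤ,
        RAM.OutputsWithin P (List.ofFn a ++ [b]) (List.ofFn x)
          (p.eval (RAM.inputSize (List.ofFn a ++ [b]))) ∧
        Knapsack.IsBoxSolution a b x ∧
        ∑ i, a i * x i = b ∧
        (Knapsack.brauerBound a < (b : ℚ) → ∀ i, 0 ≤ x i)) ∧
    (∀ (d : ℕ) (a : Fin (d + 1) → ℤ), (∀ i, 0 < a i) → Finset.univ.gcd a = 1 →
      (∃! g : Fin d → Fin d → ℤ, Knapsack.IsHermiteBasis (Knapsack.projLattice a) g) ∧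
      Knapsack.hermiteBox (Knapsack.projLattice a) =
        Set.pi Set.univ (fun i : Fin d => Set.Ico (0 : ℝ)
          ((Knapsack.prefixGcd a i.castSucc : ℝ) / (Knapsack.prefixGcd a i.succ : ℝ)))) := by
  refine ⟨⟨RAM.solve, RAM.costPoly, fun d a b ha h1 => ?_⟩, fun d a ha _ =>
    ⟨Knapsack.existsUnique_isHermiteBasis ha, Knapsack.hermiteBox_projLattice ha⟩⟩
  obtain ⟨x, hout, hx, hdig⟩ := RAM.exists_outputsWithin_solve b ha h1
  exact ⟨x, hout, Knapsack.isBoxSolution_of_digits ha hx hdig, hx,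
    Knapsack.nonneg_of_brauerBound_lt ha hx hdig⟩
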